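/- All Banach spaces are real. For a compact Hausdorff space $K$, $C(K)$ is the space of continuous real-valued functions on $K$ with the maximum norm. For a Banach space $X$ let $B_{X^*}$ and $S_{X^*}$ be the closed unit ball and the unit sphere of $X^*$, let $\operatorname{Ext} A$ denote the set of extreme points of $A$, and for $x\in X$ with $\|x\|=1$ put $\mathfrak F(x)=\{x^*\in S_{X^*}: \langle x,x^*\rangle=1\}$. A linear isometry (into) $T\colon X\to Y$ between Banach spaces is a U-embedding if for every $x^*\in S_{X^*}$ there is exactly one $y^*\in Y^*$ with $T^*y^*=x^*$ and $\|y^*\|=\|x^*\|$. A $w^*$-closed set $E\subset B_{X^*}$ is a proper U-suitable set of $X$ if (i) $E\cap(-E)\cap S_{X^*}=\emptyset$; (ii) $E\cup(-E)=\overline{\operatorname{Ext} B_{X^*}}^{\,w^*}$; (iii) $E\cap\mathfrak F(x)=E\cap\overline{\operatorname{Ext}\mathfrak F(x)}^{\,w^*}$ for every $x\in X$ with $\|x\|=1$. A simplex is a compact convex set $S$ in a locally convex space $V$ such that the cone $P=\{t(s,1): t\ge 0,\ s\in S\}\subset V\times\mathbb R$ makes $P-P$, ordered by $p\le q\iff q-p\in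 P$, a lattice. A simplexoid is a compact convex set in a locally convex space all of whose nonempty proper closed faces are simplices. Theorem. Let $X$ be a finite-dimensional Banach space. There exist a compact Hausdorff space $K$ and a U-embedding $T\colon X\to C(K)$ if and only if $X$ admits a proper U-suitable set and $B_{X^*}$, with its $w^*$-topology, is a simplexoid. -/

import Mathlib

open scoped Pointwise

universe u v w

section UEmbedding

variable {X : Type u} [NormedAddCommGroup X] [NormedSpace ℝ X]
  {Y : Type v} [NormedAddCommGroup Y] [NormedSpace ℝ Y]

/-- `g` is a Hahn--Banach (norm-preserving) extension of `f` through the isometry `T`: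
the adjoint of `T` maps `g` to `f`, and `‖g‖ = ‖f‖`. -/
def IsHahnBanachExtension (T : X →ₗᵢ[ℝ] Y) (f : StrongDual ℝ X) (g : StrongDual ℝ Y) : Prop :=
  g.comp T.toContinuousLinearMap = f ∧ ‖g‖ = ‖f‖

/-- A linear isometry into `T : X → Y` is a U-embedding if every norm-one functional on `X` has a
unique Hahn--Banach extension through `T`. -/
def IsUEmbedding (T : X →ₗᵢ[ℝ] Y) : Prop :=
  ∀ f : StrongDual ℝ X, ‖f‖ = 1 → ∃! g : StrongDual ℝ Y, IsHahnBanachExtension T f g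

end UEmbedding

/-- `X` can be U-embedded into the space `C(K)` of real continuous functions, with the maximum
norm, on some compact Hausdorff space `K`. -/
def UEmbedsInSomeCK (X : Type u) [NormedAddCommGroup X] [NormedSpace ℝ X] : Prop :=
  ∃ (K : Type v) (_ : TopologicalSpace K) (_ : CompactSpace K) (_ : T2Space K)
    (T : X →ₗᵢ[ℝ] C(K, ℝ)), IsUEmbedding T

section DualBall

variable (X : Type u) [NormedAddCommGroup X] [NormedSpace ℝ X]

/-- The closed unit ball of the dual of `X`, as a subset of the dual with its weak* topology. -/
def dualBall : Set (WeakDual ℝ X) := {f | ‖WeakDual.toStrongDual f‖ ≤ 1}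

/-- The unit sphere of the dual of `X`, as a subset of the dual with its weak* topology. -/
def dualSphere : Set (WeakDual ℝ X) := {f | ‖WeakDual.toStrongDual f‖ = 1}

variable {X}

/-- The face of the dual unit ball defined by `x`: the norm-one functionals with value `1`
at `x`. -/
def dualFace (x : X) : Set (WeakDual ℝ X) := {f | f ∈ dualSphere X ∧ f x = 1}

/-- U-suitable sets. Closedness and closures refer to the weak* topology. -/
structure IsUSuitable (E : Set (WeakDual ℝ X)) : Prop where
  subset_ball : E ⊆ dualBall X
  isClosed : IsClosed E
  inter_neg : E ∩ (-E) ∩ dualSphere X = ∅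
  union_neg : E ∪ (-E) = closure ((dualBall X).extremePoints ℝ)

/-- Proper U-suitable sets. -/
structure IsProperUSuitable (E : Set (WeakDual ℝ X)) : Prop extends IsUSuitable E where
  inter_face : ∀ x : X, ‖x‖ = 1 →
    E ∩ dualFace x = E ∩ closure ((dualFace x).extremePoints ℝ)

end DualBall

section Simplexoid

variable {V : Type w} [AddCommGroup V] [Module ℝ V]

/-- The cone in `V × ℝ` generated by `S × {1}`, for a convex set `S`. -/
def coneOver (S : Set V) : Set (V × ℝ) := {p | ∃ t : ℝ, 0 ≤ t ∧ ∃ x ∈ S, p = t • (x, (1 : ℝ))}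

/-- The vector space `coneOver S - coneOver S`, ordered by `p ≤ q ↔ q - p ∈ coneOver S`, is a
lattice. (Infima exist as soon as suprema do, because `p ↦ -p` reverses the order.) -/
def IsLatticeBase (S : Set V) : Prop :=
  ∀ p ∈ coneOver S - coneOver S, ∀ q ∈ coneOver S - coneOver S,
    ∃ r ∈ coneOver S - coneOver S,
      (r - p ∈ coneOver S ∧ r - q ∈ coneOver S) ∧
      ∀ s ∈ coneOver S - coneOver S,
        s - p ∈ coneOver S → s - q ∈ coneOver S → s - r ∈ coneOver S

variable [TopologicalSpace V]

/-- A simplex in the sense of Choquet: a compact convex set `S` such that the cone with base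
`S × {1}` induces a lattice order on the space it spans. -/
def IsChoquetSimplex (S : Set V) : Prop := IsCompact S ∧ Convex ℝ S ∧ IsLatticeBase S

/-- `F` is a nonempty proper closed face of the convex set `S`. -/
def IsProperClosedFace (S F : Set V) : Prop :=
  IsExtreme ℝ S F ∧ Convex ℝ F ∧ IsClosed F ∧ F.Nonempty ∧ F ≠ S

/-- A simplexoid: a compact convex set whose proper closed faces are simplices. -/
def IsSimplexoid (S : Set V) : Prop :=
  IsCompact S ∧ Convex ℝ S ∧ ∀ F : Set V, IsProperClosedFace S F → IsChoquetSimplex F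

end Simplexoid

/-!
For an isometry `T : X → Y`, the unit ball of `Y*` is mapped by the adjoint onto the unit ball of
`X*`, and `T` is a U-embedding exactly when the adjoint is injective on the part of the ball lying
over the unit sphere. Extreme points of the ball of `X*` lift to extreme points of the ball of `Y*`,
and the lift of an extreme point of norm one is unique when `T` is a U-embedding. If `Y = C(K)`, the
lifts are `±δ_k` (Arens–Kelley).

If `T` is a U-embedding, `{T*δ_k} ∩ S_{X*}` is therefore a proper U-suitable set. The extreme points
of a proper closed face, which lies in the unit sphere, are images of distinct signed Dirac
functionals, hence of linearly independent vectors; as the adjoint is injective over the face, they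
are affinely independent by Radon's theorem, so that the face is an ordinary finite-dimensional
simplex.

Conversely, restrict the elements of `X` to a proper U-suitable set `E`. Every norm-one functional
lies in a face `𝔉(x)`, and its norm-preserving extensions lie in the face `𝔉(T x)` of the ball of
`C(E)*`. The adjoint maps the extreme points of `𝔉(T x)` injectively to those of `𝔉(x)`, which are
affinely independent because `𝔉(x)` is a simplex, so it is injective on `𝔉(T x)`.
-/

section ConeOver

variable {V : Type w} [AddCommGroup V] [Module ℝ V] {S : Set V}

theorem smul_mem_coneOver {x : V} (hx : x ∈ S) {t : ℝ} (ht : 0 ≤ t) :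
    t • (x, (1 : ℝ)) ∈ coneOver S :=
  ⟨t, ht, x, hx, rfl⟩

theorem snd_nonneg_of_mem_coneOver {p : V × ℝ} (hp : p ∈ coneOver S) : 0 ≤ p.2 := by
  obtain ⟨t, ht, x, -, rfl⟩ := hp
  simpa using ht

theorem add_mem_coneOver (hS : Convex ℝ S) {p q : V × ℝ} (hp : p ∈ coneOver S)
    (hq : q ∈ coneOver S) : p + q ∈ coneOver S := by
  obtain ⟨a, ha, x, hx, rfl⟩ := hp
  obtain ⟨b, hb, y, hy, rfl⟩ := hq
  rcases (add_nonneg ha hb).eq_or_lt with hab | hab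
  · obtain rfl : a = 0 := by linarith
    obtain rfl : b = 0 := by linarith
    exact ⟨0, le_rfl, x, hx, by simp⟩
  · refine ⟨a + b, hab.le, (a / (a + b)) • x + (b / (a + b)) • y,
      hS hx hy (by positivity) (by positivity) (by field_simp), ?_⟩
    ext
    · simp only [Prod.smul_fst, Prod.fst_add, smul_add, smul_smul, mul_div_cancel₀ _ hab.ne']
    · simp

theorem sum_mem_coneOver (hS : Convex ℝ S) (hne : S.Nonempty) {ι : Type*} {s : Finset ι}
    {p : ι → V × ℝ} (hp : ∀ i ∈ s, p i ∈ coneOver S) : ∑ i ∈ s, p i ∈ coneOver S := by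
  refine Finset.sum_induction p (· ∈ coneOver S) (fun _ _ => add_mem_coneOver hS) ?_ hp
  exact ⟨0, le_rfl, hne.some, hne.some_mem, (zero_smul ℝ _).symm⟩

theorem eq_smul_of_sub_mem_coneOver {e : V} (he : e ∈ S.extremePoints ℝ) {p : V × ℝ} {t : ℝ}
    (hp : p ∈ coneOver S) (htp : t • (e, (1 : ℝ)) - p ∈ coneOver S) :
    p = p.2 • (e, (1 : ℝ)) := by
  obtain ⟨a, ha, x, hx, rfl⟩ := hp
  obtain ⟨b, hb, y, hy, h⟩ := htp
  have hfst : t • e - a • x = b • y := by simpa using congrArg Prod.fst h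
  have hsnd : t - a = b := by simpa using congrArg Prod.snd h
  obtain rfl : t = a + b := by linarith
  rcases ha.eq_or_lt with rfl | ha
  · simp
  suffices x = e by simp [this]
  rcases hb.eq_or_lt with rfl | hb
  · have : a • e = a • x := by simpa [sub_eq_zero] using hfst
    exact (smul_right_injective V ha.ne' this).symm
  · refine (mem_extremePoints.1 he).2 x hx y hy
      ⟨a / (a + b), b / (a + b), by positivity, by positivity, by field_simp, ?_⟩ |>.1
    rw [div_eq_inv_mul, div_eq_inv_mul, mul_smul, mul_smul, ← smul_add, ← hfst, add_sub_cancel,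
      inv_smul_smul₀ (by positivity)]

/- The infimum of the two multiples lies on both extreme rays, so it is zero and their supremum is
their sum. -/
theorem IsLatticeBase.sub_add_mem_coneOver (hL : IsLatticeBase S) (hS : Convex ℝ S) {e f : V}
    (he : e ∈ S.extremePoints ℝ) (hf : f ∈ S.extremePoints ℝ) (hef : e ≠ f) {a b : ℝ}
    (ha : 0 ≤ a) (hb : 0 ≤ b) {s : V × ℝ} (hse : s - a • (e, (1 : ℝ)) ∈ coneOver S)
    (hsf : s - b • (f, (1 : ℝ)) ∈ coneOver S) :
    s - (a • (e, (1 : ℝ)) + b • (f, (1 : ℝ))) ∈ coneOver S := by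
  set p := a • (e, (1 : ℝ))
  set q := b • (f, (1 : ℝ))
  have hp : p ∈ coneOver S := smul_mem_coneOver he.1 ha
  have hq : q ∈ coneOver S := smul_mem_coneOver hf.1 hb
  have hspan : ∀ r ∈ coneOver S, r ∈ coneOver S - coneOver S := fun r hr =>
    ⟨r, hr, 0, by simpa using smul_mem_coneOver he.1 le_rfl, sub_zero r⟩
  obtain ⟨m, -, ⟨hmp, hmq⟩, hm⟩ := hL p (hspan p hp) q (hspan q hq)
  have hinf : p + q - m ∈ coneOver S :=
    hm _ (hspan _ (add_mem_coneOver hS hp hq)) (by simpa using hq) (by simpa using hp)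
  have hinf_e : p + q - m = (p + q - m).2 • (e, (1 : ℝ)) :=
    eq_smul_of_sub_mem_coneOver he (t := a) hinf (by convert hmq using 1; abel)
  have hinf_f : p + q - m = (p + q - m).2 • (f, (1 : ℝ)) :=
    eq_smul_of_sub_mem_coneOver hf (t := b) hinf (by convert hmp using 1; abel)
  have hsnd : (p + q - m).2 = 0 := by
    by_contra h
    exact hef (smul_right_injective V h (congrArg Prod.fst (hinf_e.symm.trans hinf_f)))
  have hsup : p + q = m := by rw [← sub_eq_zero, hinf_e, hsnd, zero_smul]
  rw [hsup]
  refine hm s (hspan s ?_) hse hsf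
  simpa using add_mem_coneOver hS hse hp

theorem IsLatticeBase.nonpos_of_sub_mem_coneOver (hL : IsLatticeBase S) (hS : Convex ℝ S)
    {s : Finset (S.extremePoints ℝ)} {b : S.extremePoints ℝ → ℝ} (hb : ∀ j, 0 ≤ b j)
    {i : S.extremePoints ℝ} (hi : i ∉ s) {c : ℝ}
    (h : ∑ j ∈ s, b j • ((j : V), (1 : ℝ)) - c • ((i : V), (1 : ℝ)) ∈ coneOver S) : c ≤ 0 := by
  classical
  induction s using Finset.induction_on with
  | empty => simpa using snd_nonneg_of_mem_coneOver h
  | insert j s hj ih =>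
    obtain ⟨hij, his⟩ := not_or.1 (Finset.mem_insert.not.1 hi)
    by_contra! hc
    refine hc.not_ge (ih his ?_)
    rw [Finset.sum_insert hj] at h
    have hsum := sum_mem_coneOver hS ⟨i, i.2.1⟩ (s := s)
      fun k _ => smul_mem_coneOver k.2.1 (hb k)
    convert hL.sub_add_mem_coneOver hS i.2 j.2 (Subtype.coe_injective.ne hij) hc.le (hb j) h
      (by simpa using hsum) using 1
    abel

theorem IsLatticeBase.affineIndependent_extremePoints (hL : IsLatticeBase S) (hS : Convex ℝ S) :
    AffineIndependent ℝ ((↑) : S.extremePoints ℝ → V) := by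
  classical
  have nonpos : ∀ (s : Finset (S.extremePoints ℝ)) (w : S.extremePoints ℝ → ℝ),
      ∑ j ∈ s, w j • ((j : V), (1 : ℝ)) = 0 → ∀ i ∈ s, w i ≤ 0 := by
    intro s w hw i hi
    refine hL.nonpos_of_sub_mem_coneOver hS (fun j => abs_nonneg (w j)) (s.notMem_erase i) ?_
    rw [← Finset.add_sum_erase s _ hi, add_eq_zero_iff_eq_neg] at hw
    rw [hw, sub_neg_eq_add, ← Finset.sum_add_distrib]
    refine sum_mem_coneOver hS ⟨i, i.2.1⟩ fun j _ => ?_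
    rw [← add_smul]
    exact smul_mem_coneOver j.2.1 (by linarith [neg_abs_le (w j)])
  refine affineIndependent_iff.2 fun s w hw hsum i hi => ?_
  have hlift : ∑ j ∈ s, w j • ((j : V), (1 : ℝ)) = 0 := by
    ext1
    · simpa [Prod.fst_sum] using hsum
    · simpa [Prod.snd_sum] using hw
  refine le_antisymm (nonpos s w hlift i hi) ?_
  have := nonpos s (-w) (by simpa only [Pi.neg_apply, neg_smul, Finset.sum_neg_distrib,
    neg_eq_zero] using hlift) i hi
  simpa using this

theorem convexHull_range_eq_image_stdSimplex {ι : Type*} [Fintype ι] (e : ι → V) :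
    convexHull ℝ (Set.range e) = Fintype.linearCombination ℝ e '' stdSimplex ℝ ι := by
  classical
  rw [← convexHull_rangle_single_eq_stdSimplex, LinearMap.image_convexHull, ← Set.range_comp]
  congr 2
  ext i
  simp [Fintype.linearCombination_apply_single]

theorem coneOver_convexHull_range {ι : Type*} [Fintype ι] [Nonempty ι] (e : ι → V) :
    coneOver (convexHull ℝ (Set.range e)) =
      Fintype.linearCombination ℝ (fun i => (e i, (1 : ℝ))) '' {c | 0 ≤ c} := by
  ext p
  constructor
  · rintro ⟨t, ht, x, hx, rfl⟩
    rw [convexHull_range_eq_image_stdSimplex] at hx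
    obtain ⟨w, ⟨hw0, hw1⟩, rfl⟩ := hx
    refine ⟨t • w, fun i => mul_nonneg ht (hw0 i), ?_⟩
    ext <;> simp [Fintype.linearCombination_apply, Prod.fst_sum, Prod.snd_sum, Finset.smul_sum,
      smul_smul, ← Finset.mul_sum, hw1]
  · rintro ⟨c, hc, rfl⟩
    exact sum_mem_coneOver (convex_convexHull ℝ _) (Set.range_nonempty e).convexHull fun i _ =>
      smul_mem_coneOver (subset_convexHull ℝ _ (Set.mem_range_self i)) (hc i)

theorem isLatticeBase_convexHull_range {ι : Type*} [Finite ι] [Nonempty ι] {e : ι → V}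
    (he : AffineIndependent ℝ e) : IsLatticeBase (convexHull ℝ (Set.range e)) := by
  cases nonempty_fintype ι
  rw [IsLatticeBase, coneOver_convexHull_range]
  set L := Fintype.linearCombination ℝ (fun i => (e i, (1 : ℝ)))
  have hL : Function.Injective L := by
    refine (injective_iff_map_eq_zero L).2 fun c hc => funext fun i => ?_
    rw [Fintype.linearCombination_apply] at hc
    exact affineIndependent_iff.1 he Finset.univ c
      (by simpa [Prod.snd_sum] using congrArg Prod.snd hc)
      (by simpa [Prod.fst_sum] using congrArg Prod.fst hc) i (Finset.mem_univ i)
  have mem_cone : ∀ c, L c ∈ L '' {c | 0 ≤ c} ↔ 0 ≤ c := fun c => hL.mem_set_image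
  have mem_span : ∀ c, L c ∈ L '' {c | 0 ≤ c} - L '' {c | 0 ≤ c} := fun c =>
    ⟨L c⁺, (mem_cone _).2 (posPart_nonneg c), L c⁻, (mem_cone _).2 (negPart_nonneg c),
      (map_sub L _ _).symm.trans (by rw [posPart_sub_negPart])⟩
  rintro _ ⟨_, ⟨a, -, rfl⟩, _, ⟨a', -, rfl⟩, rfl⟩ _ ⟨_, ⟨b, -, rfl⟩, _, ⟨b', -, rfl⟩, rfl⟩
  refine ⟨L ((a - a') ⊔ (b - b')), mem_span _, ?_, ?_⟩
  · simp only [← map_sub, mem_cone, sub_nonneg]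
    exact ⟨le_sup_left, le_sup_right⟩
  · rintro _ ⟨_, ⟨c, -, rfl⟩, _, ⟨c', -, rfl⟩, rfl⟩
    simp only [← map_sub, mem_cone, sub_nonneg]
    exact sup_le

variable [TopologicalSpace V] [IsTopologicalAddGroup V] [ContinuousSMul ℝ V]
  [LocallyConvexSpace ℝ V] [T2Space V]

theorem convexHull_extremePoints_of_finite (hc : IsCompact S) (hS : Convex ℝ S)
    (hfin : (S.extremePoints ℝ).Finite) : convexHull ℝ (S.extremePoints ℝ) = S := by
  rw [← (hfin.isCompact_convexHull (𝕜 := ℝ)).isClosed.closure_eq,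
    closure_convexHull_extremePoints hc hS]

theorem isChoquetSimplex_of_affineIndependent (hc : IsCompact S)
    (hS : Convex ℝ S) (hne : S.Nonempty) (hfin : (S.extremePoints ℝ).Finite)
    (hind : AffineIndependent ℝ ((↑) : S.extremePoints ℝ → V)) : IsChoquetSimplex S := by
  have := hfin.to_subtype
  have := (hc.extremePoints_nonempty hne).to_subtype
  have hlat := isLatticeBase_convexHull_range hind
  rw [Subtype.range_coe, convexHull_extremePoints_of_finite hc hS hfin] at hlat
  exact ⟨hc, hS, hlat⟩

end ConeOver

section AffineIndependent

variable {V W : Type*} [AddCommGroup V] [Module ℝ V] [AddCommGroup W] [Module ℝ W] {ι : Type*}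
  {e : ι → V} {L : V →ₗ[ℝ] W}

theorem injOn_convexHull_of_affineIndependent_comp [Finite ι] (h : AffineIndependent ℝ (L ∘ e)) :
    Set.InjOn L (convexHull ℝ (Set.range e)) := by
  cases nonempty_fintype ι
  rw [convexHull_range_eq_image_stdSimplex]
  rintro _ ⟨a, ⟨-, ha⟩, rfl⟩ _ ⟨b, ⟨-, hb⟩, rfl⟩ hab
  have hab0 : ∑ i, (a - b) i • (L ∘ e) i = 0 := by
    simpa [Fintype.linearCombination_apply, sub_smul, sub_eq_zero] using hab
  have hweights : ∑ i, (a - b) i = 0 := by simp [ha, hb]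
  congr 1
  ext i
  exact sub_eq_zero.1 (affineIndependent_iff.1 h Finset.univ (a - b) hweights hab0 i
    (Finset.mem_univ i))

theorem affineIndependent_comp_of_injOn {C : Set V} (hC : Convex ℝ C) (hL : Set.InjOn L C)
    (he : AffineIndependent ℝ e) (heC : ∀ i, e i ∈ C) : AffineIndependent ℝ (L ∘ e) := by
  by_contra h
  obtain ⟨I, _, hI, hIc⟩ := Convex.radon_partition h
  rw [Set.image_comp, ← LinearMap.image_convexHull] at hI hIc
  obtain ⟨y, hy, rfl⟩ := hI
  obtain ⟨z, hz, hzy⟩ := hIc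
  have hull_subset (J : Set ι) : convexHull ℝ (e '' J) ⊆ C :=
    convexHull_min (Set.image_subset_iff.2 fun i _ => heC i) hC
  obtain rfl : z = y := hL (hull_subset Iᶜ hz) (hull_subset I hy) hzy
  exact Set.disjoint_left.1 (he.affineSpan_disjoint_of_disjoint disjoint_compl_right)
    (convexHull_subset_affineSpan _ hy) (convexHull_subset_affineSpan _ hz)

end AffineIndependent

section DualBall

variable {X : Type u} [NormedAddCommGroup X] [NormedSpace ℝ X]

/- Mathlib's instances are stated for `WeakBilin`, and `WeakDual` does not unfold to it during
instance search. -/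
instance instLocallyConvexSpaceWeakDual : LocallyConvexSpace ℝ (WeakDual ℝ X) :=
  inferInstanceAs (LocallyConvexSpace ℝ (WeakBilin (topDualPairing ℝ X)))

instance instFiniteDimensionalWeakDual [FiniteDimensional ℝ X] :
    FiniteDimensional ℝ (WeakDual ℝ X) :=
  Module.Finite.equiv (StrongDual.toWeakDual : StrongDual ℝ X ≃ₗ[ℝ] WeakDual ℝ X)

theorem mem_dualBall_iff {f : WeakDual ℝ X} : f ∈ dualBall X ↔ ∀ x, |f x| ≤ ‖x‖ := by
  refine ⟨fun hf x => ?_, fun hf => ?_⟩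
  · simpa using (WeakDual.toStrongDual f).le_of_opNorm_le hf x
  · exact ContinuousLinearMap.opNorm_le_bound _ zero_le_one fun x => by simpa using hf x

theorem isCompact_dualBall : IsCompact (dualBall X) := by
  convert WeakDual.isCompact_closedBall (𝕜 := ℝ) (0 : StrongDual ℝ X) 1 using 1
  ext f
  simp [dualBall]

theorem convex_dualBall : Convex ℝ (dualBall X) := by
  intro f hf g hg a b ha hb hab
  exact mem_closedBall_zero_iff.1 (convex_closedBall (0 : StrongDual ℝ X) 1
    (mem_closedBall_zero_iff.2 hf) (mem_closedBall_zero_iff.2 hg) ha hb hab)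

theorem zero_mem_dualBall : (0 : WeakDual ℝ X) ∈ dualBall X := by
  simp [dualBall]

theorem neg_mem_dualBall {f : WeakDual ℝ X} : -f ∈ dualBall X ↔ f ∈ dualBall X := by
  simp [dualBall]

theorem neg_mem_dualSphere {f : WeakDual ℝ X} : -f ∈ dualSphere X ↔ f ∈ dualSphere X := by
  simp [dualSphere]

theorem dualSphere_subset_dualBall : dualSphere X ⊆ dualBall X := fun _ hf => le_of_eq hf

theorem isClosed_dualSphere [FiniteDimensional ℝ X] : IsClosed (dualSphere X) :=
  isClosed_eq (LinearMap.continuous_of_finiteDimensional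
    (WeakDual.toStrongDual : WeakDual ℝ X ≃ₗ[ℝ] StrongDual ℝ X).toLinearMap).norm continuous_const

theorem neg_mem_extremePoints_dualBall {f : WeakDual ℝ X}
    (hf : f ∈ (dualBall X).extremePoints ℝ) : -f ∈ (dualBall X).extremePoints ℝ := by
  have neg_image : LinearEquiv.neg ℝ '' dualBall X = dualBall X := by
    ext f
    simp [neg_mem_dualBall]
  rw [← neg_image, ← image_extremePoints]
  exact ⟨f, hf, rfl⟩

theorem dualFace_eq {x : X} (hx : ‖x‖ = 1) : dualFace x = {f | f ∈ dualBall X ∧ f x = 1} := by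
  ext f
  refine ⟨fun hf => ⟨dualSphere_subset_dualBall hf.1, hf.2⟩, fun hf => ⟨hf.1.antisymm ?_, hf.2⟩⟩
  simpa [hx, hf.2] using (WeakDual.toStrongDual f).le_opNorm x

theorem isClosed_dualFace {x : X} (hx : ‖x‖ = 1) : IsClosed (dualFace x) := by
  rw [dualFace_eq hx]
  exact isCompact_dualBall.isClosed.inter
    (isClosed_eq (WeakDual.eval_continuous x) continuous_const)

theorem convex_dualFace {x : X} (hx : ‖x‖ = 1) : Convex ℝ (dualFace x) := by
  rw [dualFace_eq hx]
  refine convex_dualBall.inter fun f hf g hg a b _ _ hab => ?_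
  change a * f x + b * g x = 1
  rw [show f x = 1 from hf, show g x = 1 from hg, mul_one, mul_one, hab]

theorem isExtreme_dualFace {x : X} (hx : ‖x‖ = 1) : IsExtreme ℝ (dualBall X) (dualFace x) := by
  refine ⟨fun f hf => dualSphere_subset_dualBall hf.1, ?_⟩
  rintro f hf g hg k hk ⟨a, b, ha, hb, hab, rfl⟩
  rw [dualFace_eq hx]
  have hsum : a * f x + b * g x = 1 := hk.2
  have hfx := (le_abs_self _).trans (mem_dualBall_iff.1 hf x)
  have hgx := (le_abs_self _).trans (mem_dualBall_iff.1 hg x)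
  rw [hx] at hfx hgx
  exact ⟨hf, hfx.antisymm (by nlinarith)⟩

theorem extremePoints_dualFace_subset {x : X} (hx : ‖x‖ = 1) :
    (dualFace x).extremePoints ℝ ⊆ (dualBall X).extremePoints ℝ :=
  (isExtreme_dualFace hx).extremePoints_subset_extremePoints

theorem mem_extremePoints_dualFace {x : X} (hx : ‖x‖ = 1) {f : WeakDual ℝ X}
    (hf : f ∈ (dualBall X).extremePoints ℝ) (hfx : f x = 1) :
    f ∈ (dualFace x).extremePoints ℝ := by
  refine inter_extremePoints_subset_extremePoints_of_subset (isExtreme_dualFace hx).1 ⟨?_, hf⟩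
  rw [dualFace_eq hx]
  exact ⟨hf.1, hfx⟩

theorem exists_mem_dualFace [FiniteDimensional ℝ X] {f : WeakDual ℝ X} (hf : f ∈ dualSphere X) :
    ∃ x : X, ‖x‖ = 1 ∧ f ∈ dualFace x := by
  have := FiniteDimensional.proper ℝ X
  obtain ⟨x, hx, hmax⟩ := (isCompact_closedBall (0 : X) 1).exists_sSup_image_eq
    (Metric.nonempty_closedBall.2 zero_le_one)
    (f := fun y => ‖WeakDual.toStrongDual f y‖) (by fun_prop)
  rw [ContinuousLinearMap.sSup_unitClosedBall_eq_norm, show ‖WeakDual.toStrongDual f‖ = 1 from hf]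
    at hmax
  rw [mem_closedBall_zero_iff] at hx
  have habs : |f x| = 1 := hmax.symm
  have hx1 : ‖x‖ = 1 :=
    hx.antisymm (habs.symm.le.trans (mem_dualBall_iff.1 (dualSphere_subset_dualBall hf) x))
  rcases (abs_eq zero_le_one).1 habs with h | h
  · exact ⟨x, hx1, hf, h⟩
  · exact ⟨-x, by rwa [norm_neg], hf, by rw [map_neg, h, neg_neg]⟩

/- A point `f` of the open ball lies in the open segment from any `g` in the ball to a point
slightly beyond `f`, so a face through `f` contains every `g`. -/
theorem subset_dualSphere_of_isExtreme {F : Set (WeakDual ℝ X)} (hF : IsExtreme ℝ (dualBall X) F)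
    (hne : F ≠ dualBall X) : F ⊆ dualSphere X := by
  intro f hf
  by_contra h
  set r := ‖WeakDual.toStrongDual f‖
  have hr1 : r < 1 := lt_of_le_of_ne (hF.1 hf) h
  refine hne (hF.1.antisymm fun g hg => ?_)
  have hg1 : ‖WeakDual.toStrongDual g‖ ≤ 1 := hg
  obtain ⟨δ, hδ⟩ : ∃ δ, δ = (1 - r) / 2 := ⟨_, rfl⟩
  have hδ0 : 0 < δ := by linarith
  have hz : f + δ • (f - g) ∈ dualBall X := by
    change ‖WeakDual.toStrongDual f + δ • (WeakDual.toStrongDual f - WeakDual.toStrongDual g)‖ ≤ 1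
    calc _ ≤ r + δ * ‖WeakDual.toStrongDual f - WeakDual.toStrongDual g‖ := by
          grw [norm_add_le, norm_smul, Real.norm_of_nonneg hδ0.le]
      _ ≤ r + δ * (1 + 1) := by
          gcongr
          exact (norm_sub_le _ _).trans (add_le_add hr1.le hg1)
      _ = 1 := by rw [hδ]; ring
  refine hF.2 hg hz hf ⟨δ / (1 + δ), 1 / (1 + δ), by positivity, by positivity, by field_simp; ring,
    ?_⟩
  rw [div_eq_inv_mul, div_eq_inv_mul, mul_smul, mul_smul, ← smul_add, one_smul,
    inv_smul_eq_iff₀ (by positivity)]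
  module

theorem isProperClosedFace_dualFace {x : X} (hx : ‖x‖ = 1) (hne : (dualFace x).Nonempty) :
    IsProperClosedFace (dualBall X) (dualFace x) := by
  refine ⟨isExtreme_dualFace hx, convex_dualFace hx, isClosed_dualFace hx, hne, fun h => ?_⟩
  have h0 : (0 : WeakDual ℝ X) ∈ dualFace x := h ▸ zero_mem_dualBall
  exact zero_ne_one h0.2

theorem extremePoints_dualBall_subset_dualSphere [Nontrivial X] :
    (dualBall X).extremePoints ℝ ⊆ dualSphere X := by
  intro f hf
  refine subset_dualSphere_of_isExtreme (isExtreme_singleton.2 hf) (fun h => ?_) rfl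
  obtain ⟨g, hg, -⟩ := exists_dual_vector' ℝ (0 : X)
  have hgf : StrongDual.toWeakDual g = f := h.superset hg.le
  have h0f : 0 = f := h.superset zero_mem_dualBall
  rw [show g = 0 from hgf.trans h0f.symm, norm_zero] at hg
  exact zero_ne_one hg

theorem norm_le_of_extremePoints_dualBall {x : X} {c : ℝ}
    (h : ∀ f ∈ (dualBall X).extremePoints ℝ, |f x| ≤ c) : ‖x‖ ≤ c := by
  have hconv : Convex ℝ {f : WeakDual ℝ X | |f x| ≤ c} := fun f hf g hg a b ha hb hab =>
    mem_closedBall_zero_iff.1 (convex_closedBall (0 : ℝ) c (mem_closedBall_zero_iff.2 hf)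
      (mem_closedBall_zero_iff.2 hg) ha hb hab)
  have hball : dualBall X ⊆ {f : WeakDual ℝ X | |f x| ≤ c} := by
    rw [← closure_convexHull_extremePoints isCompact_dualBall convex_dualBall]
    exact closure_minimal (convexHull_min h hconv)
      (isClosed_le (WeakDual.eval_continuous x).abs continuous_const)
  obtain ⟨f, hf, hfx⟩ := exists_dual_vector'' ℝ x
  have hfc : |f x| ≤ c := hball (show StrongDual.toWeakDual f ∈ dualBall X from hf)
  simpa [hfx] using hfc

end DualBall

section ExtremePointsOfDualOfContinuousMap

theorem opNorm_add_opNorm_le {E : Type*} [NormedAddCommGroup E] [NormedSpace ℝ E]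
    {μ ν : StrongDual ℝ E} {c : ℝ} (h : ∀ x y, ‖x‖ ≤ 1 → ‖y‖ ≤ 1 → μ x + ν y ≤ c) :
    ‖μ‖ + ‖ν‖ ≤ c := by
  have hν : ∀ x, ‖x‖ ≤ 1 → ‖ν‖ ≤ c - μ x := fun x hx =>
    ContinuousLinearMap.opNorm_le_of_unit_norm (by simpa using h x 0 hx (by simp)) fun y hy => by
      refine abs_le'.2 ⟨by linarith [h x y hx hy.le], ?_⟩
      linarith [h x (-y) hx (by rw [norm_neg, hy]), map_neg ν y]
  have hμ : ‖μ‖ ≤ c - ‖ν‖ :=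
    ContinuousLinearMap.opNorm_le_of_unit_norm (by simpa using hν 0 (by simp)) fun x hx => by
      refine abs_le'.2 ⟨by linarith [hν x hx.le], ?_⟩
      linarith [hν (-x) (by rw [norm_neg, hx]), map_neg μ x]
  linarith

theorem exists_eq_smul_add_of_mem_extremePoints {E : Type*} [NormedAddCommGroup E]
    [NormedSpace ℝ E] {y z : E} (hyz : y + z ∈ {x : E | ‖x‖ ≤ 1}.extremePoints ℝ)
    (hnorm : ‖y‖ + ‖z‖ ≤ 1) : ∃ c : ℝ, y = c • (y + z) := by
  rcases eq_or_ne y 0 with rfl | hy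
  · exact ⟨0, (zero_smul ℝ _).symm⟩
  rcases eq_or_ne z 0 with rfl | hz
  · exact ⟨1, by simp⟩
  have hy' := norm_pos_iff.2 hy
  have hz' := norm_pos_iff.2 hz
  set s := ‖y‖ + ‖z‖
  have mem_ball : ∀ x : E, x ≠ 0 → (s / ‖x‖) • x ∈ {x : E | ‖x‖ ≤ 1} := fun x hx => by
    have := norm_pos_iff.2 hx
    rw [Set.mem_ofPred, norm_smul, Real.norm_of_nonneg (by positivity),
      div_mul_cancel₀ _ this.ne']
    exact hnorm
  have hyc : (s / ‖y‖) • y = y + z := by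
    refine (mem_extremePoints.1 hyz).2 _ (mem_ball y hy) _ (mem_ball z hz)
      ⟨‖y‖ / s, ‖z‖ / s, by positivity, by positivity, ?_, ?_⟩ |>.1
    · rw [← add_div, div_self (by positivity)]
    · rw [smul_smul, smul_smul, div_mul_div_cancel₀ (by positivity), div_self hy'.ne',
        div_mul_div_cancel₀ (by positivity), div_self hz'.ne', one_smul, one_smul]
  refine ⟨‖y‖ / s, ?_⟩
  rw [← hyc, smul_smul, div_mul_div_cancel₀ (by positivity), div_self hy'.ne', one_smul]

variable {K : Type v} [TopologicalSpace K]

/-- The Dirac functional at a point of `K`. -/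
noncomputable def diracDual (k : K) : WeakDual ℝ C(K, ℝ) :=
  StrongDual.toWeakDual (ContinuousMap.evalCLM ℝ k)

@[simp]
theorem diracDual_apply (k : K) (f : C(K, ℝ)) : diracDual k f = f k := rfl

theorem diracDual_ne_neg (k l : K) : diracDual k ≠ -diracDual l := fun h => by
  have : (1 : ℝ) = -1 := DFunLike.congr_fun h 1
  norm_num at this

theorem continuous_diracDual : Continuous (diracDual : K → WeakDual ℝ C(K, ℝ)) :=
  WeakDual.continuous_of_continuous_eval fun f => f.continuous

variable [CompactSpace K]

theorem opNorm_comp_mul_add_le (μ : StrongDual ℝ C(K, ℝ)) {φ : C(K, ℝ)}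
    (hφ : φ ∈ Set.Icc 0 1) : ‖μ.comp (ContinuousLinearMap.mul ℝ C(K, ℝ) φ)‖ +
      ‖μ.comp (ContinuousLinearMap.mul ℝ C(K, ℝ) (1 - φ))‖ ≤ ‖μ‖ := by
  refine opNorm_add_opNorm_le fun f g hf hg => ?_
  have hnorm : ‖φ * f + (1 - φ) * g‖ ≤ 1 := by
    refine (ContinuousMap.norm_le _ zero_le_one).2 fun k => ?_
    have hfk := (f.norm_coe_le_norm k).trans hf
    have hgk := (g.norm_coe_le_norm k).trans hg
    exact mem_closedBall_zero_iff.1 (convex_closedBall (0 : ℝ) 1 (mem_closedBall_zero_iff.2 hfk)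
      (mem_closedBall_zero_iff.2 hgk) (hφ.1 k) (sub_nonneg.2 (hφ.2 k)) (add_sub_cancel _ _))
  calc _ = μ (φ * f + (1 - φ) * g) := (map_add μ _ _).symm
    _ ≤ ‖μ (φ * f + (1 - φ) * g)‖ := le_abs_self _
    _ ≤ ‖μ‖ := by simpa using μ.le_opNorm_of_le hnorm

theorem exists_apply_mul_eq_of_mem_Icc {μ : WeakDual ℝ C(K, ℝ)}
    (hμ : μ ∈ (dualBall C(K, ℝ)).extremePoints ℝ) {φ : C(K, ℝ)} (hφ : φ ∈ Set.Icc 0 1) :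
    ∃ c : ℝ, ∀ f, μ (φ * f) = c * μ f := by
  set ν := (WeakDual.toStrongDual μ).comp (ContinuousLinearMap.mul ℝ C(K, ℝ) φ)
  set ν' := (WeakDual.toStrongDual μ).comp (ContinuousLinearMap.mul ℝ C(K, ℝ) (1 - φ))
  have hsum : ν + ν' = WeakDual.toStrongDual μ := by
    ext f
    change μ (φ * f) + μ ((1 - φ) * f) = μ f
    rw [← map_add, ← add_mul, add_sub_cancel, one_mul]
  obtain ⟨c, hc⟩ := exists_eq_smul_add_of_mem_extremePoints (y := ν) (z := ν')
    (by rw [hsum]; exact hμ) ((opNorm_comp_mul_add_le _ hφ).trans hμ.1)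
  rw [hsum] at hc
  exact ⟨c, fun f => DFunLike.congr_fun hc f⟩

theorem exists_mem_Icc_eq_smul_sub_smul_one (φ : C(K, ℝ)) :
    ∃ ψ ∈ Set.Icc (0 : C(K, ℝ)) 1, ∃ a b : ℝ, φ = a • ψ - b • 1 := by
  set r := ‖φ‖ + 1
  have hr : 0 < 2 * r := by positivity
  have hφr : ∀ k, |φ k| ≤ r := fun k =>
    (φ.norm_coe_le_norm k).trans (le_add_of_nonneg_right zero_le_one)
  refine ⟨(2 * r)⁻¹ • (φ + r • 1), ⟨ContinuousMap.le_def.2 fun k => ?_,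
    ContinuousMap.le_def.2 fun k => ?_⟩, 2 * r, r, ?_⟩
  · have hk : 0 ≤ φ k + r * 1 := by linarith [(abs_le.1 (hφr k)).1]
    exact mul_nonneg (inv_nonneg.2 hr.le) hk
  · have hk : φ k + r * 1 ≤ 2 * r := by linarith [(abs_le.1 (hφr k)).2]
    exact (inv_mul_le_one₀ hr).2 hk
  · rw [smul_inv_smul₀ hr.ne', add_sub_cancel_right]

theorem apply_one_mul_apply_mul_of_mem_extremePoints {μ : WeakDual ℝ C(K, ℝ)}
    (hμ : μ ∈ (dualBall C(K, ℝ)).extremePoints ℝ) (f g : C(K, ℝ)) :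
    μ 1 * μ (f * g) = μ f * μ g := by
  obtain ⟨ψ, hψ, a, b, rfl⟩ := exists_mem_Icc_eq_smul_sub_smul_one f
  obtain ⟨c, hc⟩ := exists_apply_mul_eq_of_mem_Icc hμ hψ
  have hμψ : μ ψ = c * μ 1 := by rw [← hc, mul_one]
  rw [sub_mul, smul_mul_assoc, smul_mul_assoc, one_mul, map_sub, map_sub, map_smul, map_smul,
    map_smul, map_smul, hc, hμψ]
  simp only [smul_eq_mul]
  ring

theorem diracDual_mem_dualBall (k : K) : diracDual k ∈ dualBall C(K, ℝ) :=
  mem_dualBall_iff.2 fun f => f.norm_coe_le_norm k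

theorem eq_diracDual_of_apply_eq_one {μ : WeakDual ℝ C(K, ℝ)} {k : K}
    (hμ : ∀ g : C(K, ℝ), ‖g‖ = 1 → g k = 1 → μ g = 1) : μ = diracDual k := by
  have apply_one : ∀ g : C(K, ℝ), g k = 1 → (∀ l, |g l| ≤ 1) → μ g = 1 := fun g hgk hg =>
    hμ g (le_antisymm ((ContinuousMap.norm_le _ zero_le_one).2 hg)
      (by simpa [hgk] using g.norm_coe_le_norm k)) hgk
  have hμ1 : μ 1 = 1 := apply_one 1 rfl fun l => by simp
  have apply_zero : ∀ h : C(K, ℝ), h k = 0 → (∀ l, |h l| ≤ 1) → μ h = 0 := by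
    intro h hk hle
    have h1 : μ (1 - |h|) = 1 := apply_one _ (by simp [hk]) fun l => by
      have := hle l
      simp only [ContinuousMap.sub_apply, ContinuousMap.one_apply, ContinuousMap.abs_apply]
      grind
    have h2 : μ (1 - |h| + h) = 1 := apply_one _ (by simp [hk]) fun l => by
      have := hle l
      simp only [ContinuousMap.add_apply, ContinuousMap.sub_apply, ContinuousMap.one_apply,
        ContinuousMap.abs_apply]
      grind
    rw [map_add, h1] at h2
    linarith
  refine DFunLike.ext _ _ fun f => ?_
  set h := f - f k • 1
  set r := ‖h‖ + 1
  have hr : 0 < r := by positivity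
  have hμh : μ (r⁻¹ • h) = 0 := apply_zero _ (by simp [h]) fun l => by
    have := (h.norm_coe_le_norm l).trans (le_add_of_nonneg_right zero_le_one)
    rw [ContinuousMap.smul_apply, smul_eq_mul, abs_mul, abs_of_pos (inv_pos.2 hr),
      inv_mul_le_one₀ hr]
    exact this
  rw [map_smul, smul_eq_zero_iff_right (by positivity), map_sub, map_smul, hμ1, sub_eq_zero] at hμh
  simpa using hμh

theorem diracDual_mem_extremePoints (k : K) :
    diracDual k ∈ (dualBall C(K, ℝ)).extremePoints ℝ := by
  refine mem_extremePoints_iff_left.2 ⟨diracDual_mem_dualBall k, fun μ hμ ν hν hseg => ?_⟩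
  refine eq_diracDual_of_apply_eq_one fun g hg hgk => ?_
  have hk : diracDual k ∈ dualFace g := by
    rw [dualFace_eq hg]
    exact ⟨diracDual_mem_dualBall k, hgk⟩
  exact ((isExtreme_dualFace hg).2 hμ hν hk hseg).2

variable [T2Space K]

/- Multiplying an extreme functional by a continuous function splits it into two parts whose norms
add up, hence only rescales it: up to a constant it is a character of `C(K, ℝ)`. -/
theorem eq_diracDual_or_eq_neg_of_mem_extremePoints {μ : WeakDual ℝ C(K, ℝ)}
    (hμ : μ ∈ (dualBall C(K, ℝ)).extremePoints ℝ) (hμ1 : μ ∈ dualSphere C(K, ℝ)) :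
    ∃ k, μ = diracDual k ∨ μ = -diracDual k := by
  have hmul := apply_one_mul_apply_mul_of_mem_extremePoints hμ
  have hμ0 : μ ≠ 0 := by
    rintro rfl
    simp [dualSphere] at hμ1
  have h1 : μ 1 ≠ 0 := fun h1 => hμ0 <| DFunLike.ext _ _ fun f => by
    change μ f = 0
    simpa [h1] using (hmul f f).symm
  let χ : WeakDual.characterSpace ℝ C(K, ℝ) := ⟨(μ 1)⁻¹ • μ, smul_ne_zero (inv_ne_zero h1) hμ0,
    fun f g => by
      change (μ 1)⁻¹ * μ (f * g) = (μ 1)⁻¹ * μ f * ((μ 1)⁻¹ * μ g)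
      field_simp
      linear_combination hmul f g⟩
  obtain ⟨k, hk⟩ := (WeakDual.CharacterSpace.continuousMapEval_bijective (X := K) (𝕜 := ℝ)).2 χ
  have hμk : μ = μ 1 • diracDual k := DFunLike.ext _ _ fun f => by
    have : f k = (μ 1)⁻¹ * μ f := DFunLike.congr_fun hk f
    change μ f = μ 1 * f k
    rw [this, mul_inv_cancel_left₀ h1]
  have habs : |μ 1| = 1 := by
    refine le_antisymm ?_ ?_
    · exact (mem_dualBall_iff.1 hμ.1 1).trans
        ((ContinuousMap.norm_le _ zero_le_one).2 fun l => by simp)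
    · have hle : ‖WeakDual.toStrongDual (diracDual k)‖ ≤ 1 := diracDual_mem_dualBall k
      calc 1 = ‖WeakDual.toStrongDual μ‖ := Eq.symm hμ1
        _ = ‖μ 1 • WeakDual.toStrongDual (diracDual k)‖ := congrArg (‖WeakDual.toStrongDual ·‖) hμk
        _ ≤ |μ 1| * ‖WeakDual.toStrongDual (diracDual k)‖ :=
          ContinuousLinearMap.opNorm_smul_le _ _
        _ ≤ |μ 1| := mul_le_of_le_one_right (abs_nonneg _) hle
  refine ⟨k, ((abs_eq zero_le_one).1 habs).imp (fun h => ?_) fun h => ?_⟩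
  · rwa [h, one_smul] at hμk
  · rwa [h, neg_one_smul] at hμk

theorem diracDual_injective : Function.Injective (diracDual : K → WeakDual ℝ C(K, ℝ)) :=
  fun _ _ hkl => (WeakDual.CharacterSpace.continuousMapEval_bijective (X := K) (𝕜 := ℝ)).1
    (Subtype.ext hkl)

theorem linearIndependent_diracDual :
    LinearIndependent ℝ (diracDual : K → WeakDual ℝ C(K, ℝ)) := by
  let evalHom (k : K) : C(K, ℝ) →* ℝ := ⟨⟨fun f => f k, rfl⟩, fun _ _ => rfl⟩
  have hinj : Function.Injective evalHom := fun k l hkl =>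
    diracDual_injective (DFunLike.ext _ _ fun f => DFunLike.congr_fun hkl f)
  let coe : WeakDual ℝ C(K, ℝ) →ₗ[ℝ] C(K, ℝ) → ℝ := ⟨⟨fun μ => μ, fun _ _ => rfl⟩, fun _ _ => rfl⟩
  exact LinearIndependent.of_comp coe ((linearIndependent_monoidHom C(K, ℝ) ℝ).comp evalHom hinj)

end ExtremePointsOfDualOfContinuousMap

section Adjoint

variable {X : Type u} [NormedAddCommGroup X] [NormedSpace ℝ X]
  {Y : Type v} [NormedAddCommGroup Y] [NormedSpace ℝ Y] {T : X →ₗᵢ[ℝ] Y}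

/-- The adjoint of an isometry, as a weak* continuous map between the duals. -/
noncomputable def adjoint (T : X →ₗᵢ[ℝ] Y) : WeakDual ℝ Y →L[ℝ] WeakDual ℝ X where
  toFun μ := StrongDual.toWeakDual ((WeakDual.toStrongDual μ).comp T.toContinuousLinearMap)
  map_add' _ _ := rfl
  map_smul' _ _ := rfl
  cont := WeakDual.continuous_of_continuous_eval fun x => WeakDual.eval_continuous (T x)

@[simp]
theorem adjoint_apply (μ : WeakDual ℝ Y) (x : X) : adjoint T μ x = μ (T x) := rfl

theorem adjoint_mem_dualBall {μ : WeakDual ℝ Y} (hμ : μ ∈ dualBall Y) :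
    adjoint T μ ∈ dualBall X :=
  mem_dualBall_iff.2 fun x => (mem_dualBall_iff.1 hμ (T x)).trans_eq (T.norm_map x)

theorem mem_dualSphere_of_adjoint_mem {μ : WeakDual ℝ Y} (hμ : μ ∈ dualBall Y)
    (h : adjoint T μ ∈ dualSphere X) : μ ∈ dualSphere Y := by
  refine le_antisymm hμ ?_
  rw [← show ‖WeakDual.toStrongDual (adjoint T μ)‖ = 1 from h]
  refine ContinuousLinearMap.opNorm_le_bound _ (norm_nonneg _) fun x => ?_
  simpa using (WeakDual.toStrongDual μ).le_opNorm (T x)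

theorem exists_mem_dualBall_adjoint_eq (T : X →ₗᵢ[ℝ] Y) {f : WeakDual ℝ X}
    (hf : f ∈ dualBall X) : ∃ μ ∈ dualBall Y, adjoint T μ = f := by
  let e := T.equivRange
  obtain ⟨μ, hμ, hnorm⟩ := exists_extension_norm_eq _
    ((WeakDual.toStrongDual f).comp e.symm.toLinearIsometry.toContinuousLinearMap)
  refine ⟨StrongDual.toWeakDual μ, ?_, DFunLike.ext _ _ fun x => ?_⟩
  · refine hnorm.trans_le (ContinuousLinearMap.opNorm_le_bound _ zero_le_one fun y => ?_)
    rw [one_mul, ← e.symm.norm_map y]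
    exact mem_dualBall_iff.1 hf (e.symm y)
  · exact (hμ (e x)).trans (congrArg f (e.symm_apply_apply x))

theorem image_adjoint_dualBall (T : X →ₗᵢ[ℝ] Y) : adjoint T '' dualBall Y = dualBall X :=
  Set.Subset.antisymm (Set.image_subset_iff.2 fun _ => adjoint_mem_dualBall)
    fun _ => exists_mem_dualBall_adjoint_eq T

theorem surjOn_adjoint_extremePoints (T : X →ₗᵢ[ℝ] Y) :
    Set.SurjOn (adjoint T) ((dualBall Y).extremePoints ℝ) ((dualBall X).extremePoints ℝ) := by
  rw [← image_adjoint_dualBall T]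
  exact surjOn_extremePoints_image (adjoint T).toContinuousAffineMap isCompact_dualBall

theorem isHahnBanachExtension_iff {f : WeakDual ℝ X} (hf : f ∈ dualSphere X) {μ : WeakDual ℝ Y} :
    IsHahnBanachExtension T (WeakDual.toStrongDual f) (WeakDual.toStrongDual μ) ↔
      μ ∈ dualBall Y ∧ adjoint T μ = f := by
  constructor
  · rintro ⟨hμ, hnorm⟩
    exact ⟨(hnorm.trans hf).le, hμ⟩
  · rintro ⟨hμ, rfl⟩
    exact ⟨rfl, (mem_dualSphere_of_adjoint_mem hμ hf).trans hf.symm⟩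

theorem isUEmbedding_iff_injOn_adjoint : IsUEmbedding T ↔
    Set.InjOn (adjoint T) (dualBall Y ∩ adjoint T ⁻¹' dualSphere X) := by
  constructor
  · rintro hT μ ⟨hμ, hμT⟩ ν ⟨hν, -⟩ hμν
    exact (hT _ hμT).unique ((isHahnBanachExtension_iff hμT).2 ⟨hμ, rfl⟩)
      ((isHahnBanachExtension_iff hμT).2 ⟨hν, hμν.symm⟩)
  · intro hinj f hf
    have hf' : StrongDual.toWeakDual f ∈ dualSphere X := hf
    obtain ⟨μ, hμ, hμf⟩ := exists_mem_dualBall_adjoint_eq T (dualSphere_subset_dualBall hf')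
    refine ⟨WeakDual.toStrongDual μ, (isHahnBanachExtension_iff hf').2 ⟨hμ, hμf⟩, fun ν hν => ?_⟩
    change StrongDual.toWeakDual ν = μ
    obtain ⟨hν', hνf⟩ := (isHahnBanachExtension_iff hf' (μ := StrongDual.toWeakDual ν)).1 hν
    exact hinj ⟨hν', by rwa [Set.mem_preimage, hνf]⟩
      ⟨hμ, by rwa [Set.mem_preimage, hμf]⟩ (hνf.trans hμf.symm)

theorem IsUEmbedding.adjoint_mem_extremePoints (hT : IsUEmbedding T) {μ : WeakDual ℝ Y}
    (hμ : μ ∈ (dualBall Y).extremePoints ℝ) (hμT : adjoint T μ ∈ dualSphere X) :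
    adjoint T μ ∈ (dualBall X).extremePoints ℝ := by
  refine mem_extremePoints_iff_left.2 ⟨adjoint_mem_dualBall hμ.1, ?_⟩
  rintro f hf g hg ⟨a, b, ha, hb, hab, hfg⟩
  obtain ⟨α, hα, rfl⟩ := exists_mem_dualBall_adjoint_eq T hf
  obtain ⟨β, hβ, rfl⟩ := exists_mem_dualBall_adjoint_eq T hg
  rw [← map_smul, ← map_smul, ← map_add] at hfg
  have hμαβ : a • α + b • β = μ := isUEmbedding_iff_injOn_adjoint.1 hT
    ⟨convex_dualBall hα hβ ha.le hb.le hab, by rwa [Set.mem_preimage, hfg]⟩ ⟨hμ.1, hμT⟩ hfg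
  rw [(mem_extremePoints_iff_left.1 hμ).2 α hα β hβ ⟨a, b, ha, hb, hab, hμαβ⟩]

end Adjoint

section Necessity

variable {X : Type u} [NormedAddCommGroup X] [NormedSpace ℝ X]
  {K : Type v} [TopologicalSpace K] [CompactSpace K] {T : X →ₗᵢ[ℝ] C(K, ℝ)}

theorem isProperUSuitable_of_subset_extremePoints {E : Set (WeakDual ℝ X)} (hclosed : IsClosed E)
    (hsub : E ⊆ (dualBall X).extremePoints ℝ) (hunion : E ∪ -E = (dualBall X).extremePoints ℝ)
    (hinter : E ∩ -E ∩ dualSphere X = ∅) : IsProperUSuitable E where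
  subset_ball _ hf := (hsub hf).1
  isClosed := hclosed
  inter_neg := hinter
  union_neg := by
    rw [← hunion, (hclosed.union hclosed.neg).closure_eq]
  inter_face x hx := by
    ext f
    refine and_congr_right fun hf => ⟨fun hfx => ?_, fun hfx => ?_⟩
    · exact subset_closure (mem_extremePoints_dualFace hx (hsub hf) hfx.2)
    · exact closure_minimal extremePoints_subset (isClosed_dualFace hx) hfx

theorem isProperUSuitable_extremePoints_of_subsingleton [Subsingleton X] :
    IsProperUSuitable ((dualBall X).extremePoints ℝ) := by
  have : Subsingleton (WeakDual ℝ X) := StrongDual.toWeakDual.symm.injective.subsingleton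
  refine isProperUSuitable_of_subset_extremePoints (Set.toFinite _).isClosed subset_rfl
    (Set.union_eq_left.2 fun f hf => by rwa [Subsingleton.elim f (-f)]) ?_
  refine Set.eq_empty_of_forall_notMem fun f hf => zero_ne_one (α := ℝ) ?_
  rw [← show ‖WeakDual.toStrongDual f‖ = 1 from hf.2, Subsingleton.elim f 0, map_zero, norm_zero]

theorem neg_notMem_of_convex_of_subset_dualSphere {F : Set (WeakDual ℝ X)} (hF : Convex ℝ F)
    (hsub : F ⊆ dualSphere X) {f : WeakDual ℝ X} (hf : f ∈ F) : -f ∉ F := fun hf' => by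
  have h0 : (0 : WeakDual ℝ X) ∈ F := by
    have := hF hf hf' one_half_pos.le one_half_pos.le (add_halves 1)
    rwa [smul_neg, add_neg_cancel] at this
  simpa [dualSphere] using hsub h0

variable [T2Space K]

theorem exists_eq_adjoint_diracDual_or_eq_neg (T : X →ₗᵢ[ℝ] C(K, ℝ)) {f : WeakDual ℝ X}
    (hf : f ∈ (dualBall X).extremePoints ℝ) (hf1 : f ∈ dualSphere X) :
    ∃ k, f = adjoint T (diracDual k) ∨ f = -adjoint T (diracDual k) := by
  obtain ⟨μ, hμ, rfl⟩ := surjOn_adjoint_extremePoints T hf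
  obtain ⟨k, rfl | rfl⟩ := eq_diracDual_or_eq_neg_of_mem_extremePoints hμ
    (mem_dualSphere_of_adjoint_mem hμ.1 hf1)
  · exact ⟨k, Or.inl rfl⟩
  · exact ⟨k, Or.inr (map_neg _ _)⟩

theorem IsUEmbedding.isProperUSuitable_range_inter_dualSphere [FiniteDimensional ℝ X]
    [Nontrivial X] (hT : IsUEmbedding T) :
    IsProperUSuitable (Set.range (adjoint T ∘ diracDual) ∩ dualSphere X) := by
  have hsub : Set.range (adjoint T ∘ diracDual) ∩ dualSphere X ⊆
      (dualBall X).extremePoints ℝ := by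
    rintro _ ⟨⟨k, rfl⟩, hk⟩
    exact hT.adjoint_mem_extremePoints (diracDual_mem_extremePoints k) hk
  refine isProperUSuitable_of_subset_extremePoints ?_ hsub ?_ ?_
  · exact (isCompact_range ((adjoint T).continuous.comp continuous_diracDual)).isClosed.inter
      isClosed_dualSphere
  · refine Set.Subset.antisymm (Set.union_subset hsub fun f hf => ?_) fun f hf => ?_
    · simpa using neg_mem_extremePoints_dualBall (hsub hf)
    · have hf1 := extremePoints_dualBall_subset_dualSphere hf
      obtain ⟨k, rfl | rfl⟩ := exists_eq_adjoint_diracDual_or_eq_neg T hf hf1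
      · exact Or.inl ⟨⟨k, rfl⟩, hf1⟩
      · exact Or.inr ⟨⟨k, (neg_neg _).symm⟩, neg_mem_dualSphere.2 hf1⟩
  · refine Set.eq_empty_of_forall_notMem ?_
    rintro _ ⟨⟨⟨⟨k, rfl⟩, hk⟩, ⟨l, hl⟩, -⟩, -⟩
    have hkl : adjoint T (diracDual k) = adjoint T (-diracDual l) := by
      rw [map_neg, eq_neg_iff_add_eq_zero, add_comm]
      exact eq_neg_iff_add_eq_zero.1 hl
    refine diracDual_ne_neg k l (isUEmbedding_iff_injOn_adjoint.1 hT
      ⟨diracDual_mem_dualBall k, hk⟩ ⟨neg_mem_dualBall.2 (diracDual_mem_dualBall l), ?_⟩ hkl)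
    rwa [Set.mem_preimage, ← hkl]

theorem IsUEmbedding.exists_isProperUSuitable [FiniteDimensional ℝ X] (hT : IsUEmbedding T) :
    ∃ E : Set (WeakDual ℝ X), IsProperUSuitable E := by
  cases subsingleton_or_nontrivial X
  · exact ⟨_, isProperUSuitable_extremePoints_of_subsingleton⟩
  · exact ⟨_, hT.isProperUSuitable_range_inter_dualSphere⟩

theorem linearIndependent_of_eq_diracDual_or_eq_neg {ι : Type*} {μ : ι → WeakDual ℝ C(K, ℝ)}
    {k : ι → K} (hk : Function.Injective k)
    (h : ∀ i, μ i = diracDual (k i) ∨ μ i = -diracDual (k i)) : LinearIndependent ℝ μ := by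
  have hunit : ∀ i, ∃ ε : ℝˣ, μ i = ε • diracDual (k i) := fun i => by
    rcases h i with hi | hi
    · exact ⟨1, by rw [hi, one_smul]⟩
    · exact ⟨-1, by rw [hi, Units.neg_smul, one_smul]⟩
  choose ε hε using hunit
  rw [show μ = ε • (diracDual ∘ k) from funext hε]
  exact (linearIndependent_diracDual.comp k hk).units_smul ε

theorem IsUEmbedding.affineIndependent_extremePoints (hT : IsUEmbedding T)
    {F : Set (WeakDual ℝ X)} (hF : IsExtreme ℝ (dualBall X) F) (hconv : Convex ℝ F)
    (hsub : F ⊆ dualSphere X) :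
    AffineIndependent ℝ ((↑) : F.extremePoints ℝ → WeakDual ℝ X) := by
  have hlift (e : F.extremePoints ℝ) :=
    surjOn_adjoint_extremePoints T (hF.extremePoints_subset_extremePoints e.2)
  choose μ hμ hμT using hlift
  have hdirac (e : F.extremePoints ℝ) := eq_diracDual_or_eq_neg_of_mem_extremePoints (hμ e)
    (mem_dualSphere_of_adjoint_mem (hμ e).1 (by rw [hμT]; exact hsub e.2.1))
  choose k hk using hdirac
  have hne_neg (e e' : F.extremePoints ℝ) : μ e ≠ -μ e' := fun h =>
    neg_notMem_of_convex_of_subset_dualSphere hconv hsub e'.2.1 <| by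
      rw [← hμT, ← map_neg, ← h, hμT]
      exact e.2.1
  have hkinj : Function.Injective k := fun e e' hee' => by
    have hor : μ e = μ e' ∨ μ e = -μ e' := by
      rcases hk e with h | h <;> rcases hk e' with h' | h' <;> simp [h, h', hee']
    exact Subtype.ext (by rw [← hμT, ← hμT, hor.resolve_right (hne_neg e e')])
  have hindep : AffineIndependent ℝ μ :=
    (linearIndependent_of_eq_diracDual_or_eq_neg hkinj hk).affineIndependent
  have hinj : Set.InjOn (adjoint T) (dualBall C(K, ℝ) ∩ adjoint T ⁻¹' F) :=
    (isUEmbedding_iff_injOn_adjoint.1 hT).mono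
      (Set.inter_subset_inter_right _ (Set.preimage_mono hsub))
  rw [← show adjoint T ∘ μ = ((↑) : F.extremePoints ℝ → WeakDual ℝ X) from funext hμT]
  exact affineIndependent_comp_of_injOn (L := (adjoint T).toLinearMap)
    (convex_dualBall.inter (hconv.linear_preimage (adjoint T).toLinearMap)) hinj hindep
    fun e => ⟨(hμ e).1, (congrArg (· ∈ F) (hμT e)).mpr e.2.1⟩

theorem IsUEmbedding.isSimplexoid_dualBall [FiniteDimensional ℝ X] (hT : IsUEmbedding T) :
    IsSimplexoid (dualBall X) := by
  refine ⟨isCompact_dualBall, convex_dualBall, ?_⟩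
  rintro F ⟨hF, hconv, hclosed, hne, hproper⟩
  have hind := hT.affineIndependent_extremePoints hF hconv
    (subset_dualSphere_of_isExtreme hF hproper)
  have := finite_of_fin_dim_affineIndependent ℝ hind
  exact isChoquetSimplex_of_affineIndependent
    (isCompact_dualBall.of_isClosed_subset hclosed hF.1) hconv hne (Set.toFinite _) hind

end Necessity

section Sufficiency

variable {X : Type u} [NormedAddCommGroup X] [NormedSpace ℝ X]
  {Y : Type v} [NormedAddCommGroup Y] [NormedSpace ℝ Y]
  {K : Type v} [TopologicalSpace K] [CompactSpace K] {E : Set (WeakDual ℝ X)}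

theorem IsSimplexoid.affineIndependent_extremePoints_dualFace (hS : IsSimplexoid (dualBall X))
    {x : X} (hx : ‖x‖ = 1) :
    AffineIndependent ℝ ((↑) : (dualFace x).extremePoints ℝ → WeakDual ℝ X) := by
  rcases (dualFace x).eq_empty_or_nonempty with hempty | hne
  · have : IsEmpty ((dualFace x).extremePoints ℝ) :=
      Set.isEmpty_coe_sort.2 (by rw [hempty, extremePoints_empty])
    exact affineIndependent_of_subsingleton ℝ _
  · obtain ⟨-, hconv, hlattice⟩ := hS.2.2 _ (isProperClosedFace_dualFace hx hne)
    exact hlattice.affineIndependent_extremePoints hconv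

theorem isUEmbedding_of_injOn_extremePoints_dualFace [FiniteDimensional ℝ X] {T : X →ₗᵢ[ℝ] Y}
    (hS : IsSimplexoid (dualBall X))
    (hmaps : ∀ x, ‖x‖ = 1 →
      Set.MapsTo (adjoint T) ((dualFace (T x)).extremePoints ℝ) ((dualFace x).extremePoints ℝ))
    (hinj : ∀ x, ‖x‖ = 1 → Set.InjOn (adjoint T) ((dualFace (T x)).extremePoints ℝ)) :
    IsUEmbedding T := by
  refine isUEmbedding_iff_injOn_adjoint.2 fun μ hμ ν hν hμν => ?_
  obtain ⟨x, hx, hμx⟩ := exists_mem_dualFace hμ.2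
  have hTx : ‖T x‖ = 1 := (T.norm_map x).trans hx
  have hind := (hS.affineIndependent_extremePoints_dualFace hx).comp_embedding
    ⟨(hmaps x hx).restrict, (hmaps x hx).restrict_inj.2 (hinj x hx)⟩
  have := finite_of_fin_dim_affineIndependent ℝ hind
  have hinjOn : Set.InjOn (adjoint T) (dualFace (T x)) := by
    rw [← convexHull_extremePoints_of_finite
      (isCompact_dualBall.of_isClosed_subset (isClosed_dualFace hTx) (isExtreme_dualFace hTx).1)
      (convex_dualFace hTx) (Set.toFinite _), ← Subtype.range_coe (s := Set.extremePoints _ _)]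
    exact injOn_convexHull_of_affineIndependent_comp (L := (adjoint T).toLinearMap) hind
  have hνx : ν (T x) = 1 := by
    rw [← adjoint_apply, ← hμν]
    exact hμx.2
  exact hinjOn (by rw [dualFace_eq hTx]; exact ⟨hμ.1, hμx.2⟩)
    (by rw [dualFace_eq hTx]; exact ⟨hν.1, hνx⟩) hμν

theorem IsUSuitable.ne_neg (hE : IsUSuitable E) {f g : WeakDual ℝ X} (hf : f ∈ E) (hg : g ∈ E)
    (hf1 : f ∈ dualSphere X) : f ≠ -g := by
  rintro rfl
  exact hE.inter_neg.subset ⟨⟨hf, by simpa using hg⟩, hf1⟩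

theorem IsProperUSuitable.mem_extremePoints_dualFace [FiniteDimensional ℝ X]
    (hE : IsProperUSuitable E) (hS : IsSimplexoid (dualBall X)) {x : X} (hx : ‖x‖ = 1)
    {f : WeakDual ℝ X} (hf : f ∈ E ∪ -E) (hfx : f x = 1) :
    f ∈ (dualFace x).extremePoints ℝ := by
  have mem_of_mem : ∀ {y : X} {g : WeakDual ℝ X}, ‖y‖ = 1 → g ∈ E → g y = 1 →
      g ∈ (dualFace y).extremePoints ℝ := fun {y g} hy hg hgy => by
    have := finite_of_fin_dim_affineIndependent ℝ
      (hS.affineIndependent_extremePoints_dualFace hy)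
    have hgface : g ∈ dualFace y := by
      rw [dualFace_eq hy]
      exact ⟨hE.subset_ball hg, hgy⟩
    rw [← (Set.toFinite ((dualFace y).extremePoints ℝ)).isClosed.closure_eq]
    exact ((hE.inter_face y hy).subset ⟨hg, hgface⟩).2
  rcases hf with hf | hf
  · exact mem_of_mem hx hf hfx
  · have hnx : ‖-x‖ = 1 := by rwa [norm_neg]
    have hnf := mem_of_mem hnx hf (by change -f (-x) = 1; rw [map_neg, neg_neg, hfx])
    have hfext := neg_mem_extremePoints_dualBall (extremePoints_dualFace_subset hnx hnf)
    rw [neg_neg] at hfext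
    exact _root_.mem_extremePoints_dualFace hx hfext hfx

/-- The evaluation of the elements of `X` on a U-suitable set parametrized by `K`. -/
noncomputable def evalEmbedding (φ : C(K, WeakDual ℝ X)) (hφ : IsUSuitable (Set.range φ)) :
    X →ₗᵢ[ℝ] C(K, ℝ) where
  toFun x := ⟨fun k => φ k x, (WeakDual.eval_continuous x).comp φ.continuous⟩
  map_add' x y := ContinuousMap.ext fun k => map_add (φ k) x y
  map_smul' a x := ContinuousMap.ext fun k => map_smul (φ k) a x
  norm_map' x := by
    let g : C(K, ℝ) := ⟨fun k => φ k x, (WeakDual.eval_continuous x).comp φ.continuous⟩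
    change ‖g‖ = ‖x‖
    refine le_antisymm ((ContinuousMap.norm_le _ (norm_nonneg x)).2 fun k =>
      mem_dualBall_iff.1 (hφ.subset_ball ⟨k, rfl⟩) x)
      (norm_le_of_extremePoints_dualBall fun f hf => ?_)
    rcases hφ.union_neg.superset (subset_closure hf) with ⟨k, rfl⟩ | ⟨k, hk⟩
    · exact g.norm_coe_le_norm k
    · rw [← abs_neg, show -f x = φ k x from (DFunLike.congr_fun hk x).symm]
      exact g.norm_coe_le_norm k

theorem adjoint_evalEmbedding_diracDual {φ : C(K, WeakDual ℝ X)} (hφ : IsUSuitable (Set.range φ))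
    (k : K) : adjoint (evalEmbedding φ hφ) (diracDual k) = φ k := rfl

theorem isUEmbedding_evalEmbedding [FiniteDimensional ℝ X] [T2Space K] {φ : C(K, WeakDual ℝ X)}
    (hφ : IsProperUSuitable (Set.range φ)) (hinj : Function.Injective φ)
    (hS : IsSimplexoid (dualBall X)) : IsUEmbedding (evalEmbedding φ hφ.toIsUSuitable) := by
  set T := evalEmbedding φ hφ.toIsUSuitable
  have hdirac : ∀ {x : X}, ‖x‖ = 1 → ∀ μ ∈ (dualFace (T x)).extremePoints ℝ,
      ∃ k, μ = diracDual k ∨ μ = -diracDual k := fun hx μ hμ =>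
    eq_diracDual_or_eq_neg_of_mem_extremePoints
      (extremePoints_dualFace_subset ((T.norm_map _).trans hx) hμ) hμ.1.1
  have hmaps : ∀ x, ‖x‖ = 1 →
      Set.MapsTo (adjoint T) ((dualFace (T x)).extremePoints ℝ) ((dualFace x).extremePoints ℝ) := by
    intro x hx μ hμ
    refine hφ.mem_extremePoints_dualFace hS hx ?_ hμ.1.2
    obtain ⟨k, rfl | rfl⟩ := hdirac hx μ hμ
    · exact Or.inl ⟨k, rfl⟩
    · exact Or.inr ⟨k, by rw [map_neg, neg_neg, adjoint_evalEmbedding_diracDual]⟩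
  refine isUEmbedding_of_injOn_extremePoints_dualFace hS hmaps fun x hx μ hμ ν hν hμν => ?_
  have hsph : adjoint T μ ∈ dualSphere X := (hmaps x hx hμ).1.1
  have hne (k l : K) (hk : φ k ∈ dualSphere X) : φ k ≠ -φ l :=
    hφ.ne_neg ⟨k, rfl⟩ ⟨l, rfl⟩ hk
  obtain ⟨k, rfl | rfl⟩ := hdirac hx μ hμ <;> obtain ⟨l, rfl | rfl⟩ := hdirac hx ν hν <;>
    simp only [map_neg, neg_inj, neg_mem_dualSphere, T, adjoint_evalEmbedding_diracDual] at hμν hsph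
  · rw [hinj hμν]
  · exact (hne k l hsph hμν).elim
  · exact (hne k l hsph (neg_eq_iff_eq_neg.1 hμν)).elim
  · rw [hinj hμν]

theorem small_weakDual [FiniteDimensional ℝ X] : Small.{w} (WeakDual ℝ X) :=
  let b := Module.finBasis ℝ (WeakDual ℝ X)
  small_of_injective (β := Fin (Module.finrank ℝ (WeakDual ℝ X)) → ℝ) b.equivFun.injective

theorem IsProperUSuitable.uEmbedsInSomeCK [FiniteDimensional ℝ X] (hE : IsProperUSuitable E)
    (hS : IsSimplexoid (dualBall X)) : UEmbedsInSomeCK.{u, v} X := by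
  have : Small.{v} (WeakDual ℝ X) := small_weakDual
  have : CompactSpace E := isCompact_iff_compactSpace.1
    (isCompact_dualBall.of_isClosed_subset hE.isClosed hE.subset_ball)
  let ψ : Shrink.{v} E ≃ₜ E := (Shrink.homeomorph E).symm
  have : CompactSpace (Shrink.{v} E) := ψ.symm.compactSpace
  have : T2Space (Shrink.{v} E) := ψ.symm.t2Space
  let φ : C(Shrink.{v} E, WeakDual ℝ X) := ⟨fun k => ψ k, by fun_prop⟩
  have hrange : Set.range φ = E := by
    rw [show (φ : Shrink.{v} E → WeakDual ℝ X) = Subtype.val ∘ ψ from rfl,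
      ψ.surjective.range_comp, Subtype.range_coe]
  rw [← hrange] at hE
  exact ⟨Shrink.{v} E, inferInstance, inferInstance, inferInstance, _,
    isUEmbedding_evalEmbedding hE (Subtype.val_injective.comp ψ.injective) hS⟩

end Sufficiency

theorem mainTheorem4 (X : Type u) [NormedAddCommGroup X] [NormedSpace ℝ X]
    [FiniteDimensional ℝ X] :
    UEmbedsInSomeCK.{u, v} X ↔
      (∃ E : Set (WeakDual ℝ X), IsProperUSuitable E) ∧ IsSimplexoid (dualBall X) := by
  constructor
  · rintro ⟨K, _, _, _, T, hT⟩
    exact ⟨hT.exists_isProperUSuitable, hT.isSimplexoid_dualBall⟩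
  · rintro ⟨⟨E, hE⟩, hS⟩
    exact hE.uEmbedsInSomeCK hS
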